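/- Let $A\in\mathbb{R}^{d\times d}$ be symmetric (possibly indefinite, possibly singular) and $b\in\mathbb{R}^d$. For $j\ge 0$ let $\mathcal{K}_j(A,b)=\operatorname{span}\{b,Ab,\dots,A^{j-1}b\}$. If $Q=[q_1,\dots,q_j]\in\mathbb{R}^{d\times j}$ has orthonormal columns with $\operatorname{span}\{q_1,\dots,q_i\}=\mathcal{K}_i(A,b)$ for all $i\le j$, put $T=Q^{\mathsf T}AQ$ and define the $j$-th Lanczos-FA (CG) iterate for $f(x)=1/x$ by $\mathsf{lan}_j(1/x)=Q\,f(T)\,Q^{\mathsf T}b=Q\,T^{-1}Q^{\mathsf T}b$; it is well defined if such a $Q$ exists and $T$ is nonsingular (in particular $\mathsf{lan}_0(1/x)=0$). Theorem. For every integer $k\ge 1$ there exists an integer $k^*$ with $0\le k^*\le k$ such that the iterate $\mathsf{lan}_{k^*}(1/x)$ is well defined (a basis $Q$ as above with $k^*$ columns exists, and for every such $Q$ the matrix $T$ is nonsingular) and, for every such $Q$, $$\|b-A\,\mathsf{lan}_{k^*}(1/x)\|_2\le\Bigl(\mathrm{e}\sqrt{k}+\frac1{\sqrt{k}}\Bigr)\min_{\deg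 p<k}\|b-A\,p(A)b\|_2 .$$ If moreover $A$ is nonsingular, then for the same $k^*$ also $$\|A^{-1}b-\mathsf{lan}_{k^*}(1/x)\|_2\le\kappa(A)\Bigl(\mathrm{e}\sqrt{k}+\frac1{\sqrt{k}}\Bigr)\min_{\deg p<k}\|A^{-1}b-p(A)b\|_2 ,$$ where $\kappa(A)$ is the ratio of the largest to the smallest magnitude of an eigenvalue of $A$. Here $p$ ranges over real polynomials. -/

import Mathlib

open scoped Polynomial Matrix

noncomputable section

namespace LanczosFA

/-- The Krylov subspace `span {b, A b, …, A ^ (k - 1) b}`. -/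
def krylov {d : ℕ} (A : Matrix (Fin d) (Fin d) ℝ) (b : EuclideanSpace ℝ (Fin d)) (k : ℕ) :
    Submodule ℝ (EuclideanSpace ℝ (Fin d)) :=
  Submodule.span ℝ (Set.range fun i : Fin k => Matrix.toEuclideanLin (A ^ (i : ℕ)) b)

/-- The columns `q₁, …, q_k` of `Q` are orthonormal and, for every `j ≤ k`, the first `j` of them
span the Krylov subspace of order `j`. -/
structure IsLanczosBasis {d k : ℕ} (A : Matrix (Fin d) (Fin d) ℝ)
    (b : EuclideanSpace ℝ (Fin d)) (Q : Matrix (Fin d) (Fin k) ℝ) : Prop where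
  orthonormal : Orthonormal ℝ fun i : Fin k => WithLp.toLp 2 (Q.col i)
  span_eq : ∀ j ≤ k,
    Submodule.span ℝ ((fun i : Fin k => WithLp.toLp 2 (Q.col i)) '' {i | (i : ℕ) < j}) =
      krylov A b j

/-- The projected matrix `T = Qᵀ A Q`. -/
def projected {d k : ℕ} (A : Matrix (Fin d) (Fin d) ℝ) (Q : Matrix (Fin d) (Fin k) ℝ) :
    Matrix (Fin k) (Fin k) ℝ :=
  Qᵀ * A * Q

/-- The Lanczos-FA iterate `Q f(T) Qᵀ b`. For a symmetric matrix `T`, `cfc f T` is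
`∑ i, f (λ i) • u i * (u i)ᵀ`, where `λ i`, `u i` are the eigenvalues and eigenvectors of `T`
(every function is continuous on the finite spectrum). For `f = 1 / x` the iterate is defined only
if `T` is nonsingular. -/
def lan {d k : ℕ} (A : Matrix (Fin d) (Fin d) ℝ) (b : EuclideanSpace ℝ (Fin d))
    (Q : Matrix (Fin d) (Fin k) ℝ) (f : ℝ → ℝ) : EuclideanSpace ℝ (Fin d) :=
  Matrix.toEuclideanLin (Q * cfc f (projected A Q) * Qᵀ) b

/-- The values `‖b - A p(A) b‖₂`, where `deg p < k`. -/
def residualNorms {d : ℕ} (A : Matrix (Fin d) (Fin d) ℝ) (b : EuclideanSpace ℝ (Fin d)) (k : ℕ) :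
    Set ℝ :=
  {r | ∃ p : ℝ[X], p.degree < k ∧
    r = ‖b - Matrix.toEuclideanLin (A * Polynomial.aeval A p) b‖}

/-- `min_{deg p < k} ‖b - A p(A) b‖₂`; it is attained, see `isLeast_minResidual`. -/
def minResidual {d : ℕ} (A : Matrix (Fin d) (Fin d) ℝ) (b : EuclideanSpace ℝ (Fin d)) (k : ℕ) :
    ℝ :=
  sInf (residualNorms A b k)

/-- The values `‖A⁻¹ b - p(A) b‖₂`, where `deg p < k`. -/
def errorNorms {d : ℕ} (A : Matrix (Fin d) (Fin d) ℝ) (b : EuclideanSpace ℝ (Fin d)) (k : ℕ) :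
    Set ℝ :=
  {r | ∃ p : ℝ[X], p.degree < k ∧
    r = ‖Matrix.toEuclideanLin A⁻¹ b - Matrix.toEuclideanLin (Polynomial.aeval A p) b‖}

/-- `min_{deg p < k} ‖A⁻¹ b - p(A) b‖₂`; it is attained, see `isLeast_minError`. -/
def minError {d : ℕ} (A : Matrix (Fin d) (Fin d) ℝ) (b : EuclideanSpace ℝ (Fin d)) (k : ℕ) : ℝ :=
  sInf (errorNorms A b k)

/-- For symmetric nonsingular `A`, the ratio of the largest to the smallest magnitude of an
eigenvalue. -/
def cond {d : ℕ} (A : Matrix (Fin d) (Fin d) ℝ) : ℝ :=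
  sSup ((fun x : ℝ => |x|) '' spectrum ℝ A) / sInf ((fun x : ℝ => |x|) '' spectrum ℝ A)

theorem isLeast_sInf_norm_sub {d : ℕ} (v : EuclideanSpace ℝ (Fin d)) (k : ℕ)
    (L : ℝ[X] →ₗ[ℝ] EuclideanSpace ℝ (Fin d)) :
    IsLeast {r : ℝ | ∃ p : ℝ[X], p.degree < k ∧ r = ‖v - L p‖}
      (sInf {r : ℝ | ∃ p : ℝ[X], p.degree < k ∧ r = ‖v - L p‖}) := by
  set S := {r : ℝ | ∃ p : ℝ[X], p.degree < k ∧ r = ‖v - L p‖} with hS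
  have hbdd : BddBelow S := ⟨0, by rintro r ⟨p, -, rfl⟩; exact norm_nonneg _⟩
  refine ⟨?_, fun r hr => csInf_le hbdd hr⟩
  let W := (Polynomial.degreeLT ℝ k).map L
  have hW : W.starProjection v ∈ W := W.starProjection_apply_mem v
  obtain ⟨p, hp, hpv⟩ := Submodule.mem_map.1 hW
  have hpS : ‖v - L p‖ ∈ S := ⟨p, Polynomial.mem_degreeLT.1 hp, rfl⟩
  have hle : sInf S = ‖v - L p‖ := by
    refine le_antisymm (csInf_le hbdd hpS) (le_csInf ⟨_, hpS⟩ ?_)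
    rintro r ⟨q, hq, rfl⟩
    rw [hpv, W.starProjection_minimal v]
    exact ciInf_le ⟨0, by rintro _ ⟨w, rfl⟩; exact norm_nonneg _⟩
      (⟨L q, Submodule.mem_map_of_mem (Polynomial.mem_degreeLT.2 hq)⟩ : W)
  rw [hle]
  exact hpS

theorem isLeast_minError {d : ℕ} (A : Matrix (Fin d) (Fin d) ℝ)
    (b : EuclideanSpace ℝ (Fin d)) (k : ℕ) : IsLeast (errorNorms A b k) (minError A b k) :=
  isLeast_sInf_norm_sub (Matrix.toEuclideanLin A⁻¹ b) k
    ((LinearMap.applyₗ b ∘ₗ (Matrix.toEuclideanLin (𝕜 := ℝ) (m := Fin d) (n := Fin d)).toLinearMap)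
      ∘ₗ (Polynomial.aeval A).toLinearMap)

theorem isLeast_minResidual {d : ℕ} (A : Matrix (Fin d) (Fin d) ℝ)
    (b : EuclideanSpace ℝ (Fin d)) (k : ℕ) : IsLeast (residualNorms A b k) (minResidual A b k) :=
  isLeast_sInf_norm_sub b k
    ((LinearMap.applyₗ b ∘ₗ (Matrix.toEuclideanLin (𝕜 := ℝ) (m := Fin d) (n := Fin d)).toLinearMap)
      ∘ₗ (LinearMap.mulLeft ℝ A) ∘ₗ (Polynomial.aeval A).toLinearMap)

end LanczosFA

end

noncomputable section

/-! Write ρ_n for `minResidual A b n` and τ_n for the residual norm of the n-th Galerkin (CG)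
iterate. The sequence ρ is nonincreasing with ρ_0 = ‖b‖ = τ_0. Whenever ρ_{n+1} < ρ_n, the iterate
of order n + 1 is well defined (`isUnit_projected`) and 1/τ_{n+1}² = 1/ρ_{n+1}² - 1/ρ_n²
(`norm_galerkin_residual`, in division-free form).

If ρ_k > 0, then 1/ρ_0² and the k increments of 1/ρ² add up to 1/ρ_k², so one of these k + 1 terms
is at least the average 1/((k + 1)ρ_k²). It is positive, so its index gives a well-defined iterate
with residual at most √(k + 1) ρ_k. The cross-multiplied `exists_large_drop` also covers ρ_k = 0.
The stated constant exceeds √(k + 1), and applying A to errors turns them into residuals at the cost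
of κ(A). -/

open Polynomial in
/-- The map `p ↦ p(A) b`. -/
def LanczosFA.krylovMap {d : ℕ} (A : Matrix (Fin d) (Fin d) ℝ) (b : EuclideanSpace ℝ (Fin d)) :
    ℝ[X] →ₗ[ℝ] EuclideanSpace ℝ (Fin d) :=
  (LinearMap.applyₗ b ∘ₗ (Matrix.toEuclideanLin (𝕜 := ℝ) (m := Fin d) (n := Fin d)).toLinearMap)
    ∘ₗ (Polynomial.aeval A).toLinearMap

namespace LanczosFA

open Polynomial
open scoped RealInnerProductSpace

/-! ### Krylov subspaces as images of polynomials -/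

section KrylovMap

variable {d : ℕ} (A : Matrix (Fin d) (Fin d) ℝ) (b : EuclideanSpace ℝ (Fin d))

theorem krylovMap_apply (p : ℝ[X]) :
    krylovMap A b p = Matrix.toEuclideanLin (aeval A p) b := rfl

theorem toEuclideanLin_mul_apply {l m n : ℕ} (M : Matrix (Fin l) (Fin m) ℝ)
    (N : Matrix (Fin m) (Fin n) ℝ) (v : EuclideanSpace ℝ (Fin n)) :
    Matrix.toEuclideanLin (M * N) v = Matrix.toEuclideanLin M (Matrix.toEuclideanLin N v) := by
  simp [Matrix.toLpLin_apply, Matrix.mulVec_mulVec]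

theorem toEuclideanLin_one_apply {n : ℕ} (v : EuclideanSpace ℝ (Fin n)) :
    Matrix.toEuclideanLin (1 : Matrix (Fin n) (Fin n) ℝ) v = v := by
  simp

theorem inner_toEuclideanLin_left {m n : ℕ} (M : Matrix (Fin m) (Fin n) ℝ)
    (v : EuclideanSpace ℝ (Fin n)) (w : EuclideanSpace ℝ (Fin m)) :
    ⟪Matrix.toEuclideanLin M v, w⟫ = ⟪v, Matrix.toEuclideanLin Mᵀ w⟫ := by
  rw [← Matrix.conjTranspose_eq_transpose_of_trivial, Matrix.toEuclideanLin_conjTranspose_eq_adjoint,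
    LinearMap.adjoint_inner_right]

theorem krylovMap_mul (p q : ℝ[X]) :
    krylovMap A b (p * q) = Matrix.toEuclideanLin (aeval A p) (krylovMap A b q) := by
  simp only [krylovMap_apply, map_mul, toEuclideanLin_mul_apply]

theorem krylovMap_X_mul (q : ℝ[X]) :
    krylovMap A b (X * q) = Matrix.toEuclideanLin A (krylovMap A b q) := by
  rw [krylovMap_mul, aeval_X]

theorem krylovMap_one : krylovMap A b 1 = b := by
  rw [krylovMap_apply, map_one, toEuclideanLin_one_apply]

theorem krylovMap_one_sub_X_mul (p : ℝ[X]) :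
    krylovMap A b (1 - X * p) = b - Matrix.toEuclideanLin (A * aeval A p) b := by
  rw [map_sub, krylovMap_one, krylovMap_apply, map_mul, aeval_X]

/-- The kernel of `krylovMap` is an ideal of ℝ[X]. -/
theorem krylovMap_mod {q : ℝ[X]} (hq : krylovMap A b q = 0) (p : ℝ[X]) :
    krylovMap A b (p % q) = krylovMap A b p := by
  conv_rhs => rw [← EuclideanDomain.div_add_mod p q, map_add, mul_comm, krylovMap_mul, hq]
  simp

theorem krylov_eq_map (k : ℕ) : krylov A b k = (degreeLT ℝ k).map (krylovMap A b) := by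
  rw [degreeLT_eq_span_X_pow, Submodule.map_span, krylov]
  congr 1
  ext v
  simp only [Set.mem_range, Finset.coe_image, Set.mem_image, Finset.coe_range, Set.mem_Iio,
    exists_exists_and_eq_and]
  constructor
  · rintro ⟨i, rfl⟩
    exact ⟨i, i.2, by simp [krylovMap_apply]⟩
  · rintro ⟨i, hi, rfl⟩
    exact ⟨⟨i, hi⟩, by simp [krylovMap_apply]⟩

theorem mem_krylov {k : ℕ} {v : EuclideanSpace ℝ (Fin d)} :
    v ∈ krylov A b k ↔ ∃ p : ℝ[X], p.degree < k ∧ krylovMap A b p = v := by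
  simp [krylov_eq_map, mem_degreeLT]

theorem degree_X_mul_lt {p : ℝ[X]} {n : ℕ} (hp : p.degree < n) : (X * p : ℝ[X]).degree < (n + 1 : ℕ) := by
  rw [degree_lt_iff_coeff_zero] at hp ⊢
  rintro (_ | m) hm
  · omega
  · rw [coeff_X_mul]
    exact hp m (by omega)

theorem degree_one_sub_X_mul_lt {p : ℝ[X]} {n : ℕ} (hp : p.degree < n) :
    (1 - X * p : ℝ[X]).degree < (n + 1 : ℕ) := by
  refine (degree_sub_le _ _).trans_lt (max_lt ?_ (degree_X_mul_lt hp))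
  rw [degree_one]
  exact_mod_cast Nat.succ_pos n

theorem degree_sub_lt_of_lt {p q : ℝ[X]} {n : ℕ} (hp : p.degree < n) (hq : q.degree < n) :
    (p - q).degree < n :=
  (degree_sub_le _ _).trans_lt (max_lt hp hq)

theorem degree_lt_succ_of_lt {p : ℝ[X]} {n : ℕ} (hp : p.degree < n) : p.degree < (n + 1 : ℕ) :=
  hp.trans (by exact_mod_cast Nat.lt_succ_self n)

/-- Degree < n has codimension one in degree < n + 1; this isolates the single new direction at each
step. -/
theorem exists_degree_sub_C_mul_lt {p w : ℝ[X]} {n : ℕ} (hw : w.degree < (n + 1 : ℕ))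
    (hw' : ¬ w.degree < n) (hp : p.degree < (n + 1 : ℕ)) :
    ∃ c : ℝ, (p - C c * w).degree < n := by
  rw [degree_lt_iff_coeff_zero] at hp hw
  have h0 : w.coeff n ≠ 0 := fun h => hw' <| (degree_lt_iff_coeff_zero _ _).2 fun m hm => by
    rcases hm.eq_or_lt with rfl | hm
    · exact h
    · exact hw m hm
  refine ⟨p.coeff n / w.coeff n, (degree_lt_iff_coeff_zero _ _).2 fun m hm => ?_⟩
  rw [coeff_sub, coeff_C_mul]
  rcases hm.eq_or_lt with rfl | hm
  · field_simp
    ring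
  · rw [hp m hm, hw m hm]
    ring

/-! ### Minimal residuals and the Galerkin condition -/

/-- The polynomial `p` solves the normal equations of the minimal residual problem of order `n`. -/
structure IsMinresPoly (n : ℕ) (p : ℝ[X]) : Prop where
  degree_lt : p.degree < n
  orthogonal : ∀ q : ℝ[X], q.degree < n →
    ⟪krylovMap A b (X * q), krylovMap A b (1 - X * p)⟫ = 0

variable {A b}

theorem minResidual_le {n : ℕ} {p : ℝ[X]} (hp : p.degree < n) :
    minResidual A b n ≤ ‖krylovMap A b (1 - X * p)‖ :=
  (isLeast_minResidual A b n).2 ⟨p, hp, by rw [krylovMap_one_sub_X_mul]⟩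

theorem minResidual_nonneg (n : ℕ) : 0 ≤ minResidual A b n := by
  obtain ⟨p, -, h⟩ := (isLeast_minResidual A b n).1
  rw [h]
  exact norm_nonneg _

theorem minResidual_succ_le (n : ℕ) : minResidual A b (n + 1) ≤ minResidual A b n := by
  obtain ⟨p, hp, h⟩ := (isLeast_minResidual A b n).1
  rw [h, ← krylovMap_one_sub_X_mul]
  exact minResidual_le (degree_lt_succ_of_lt hp)

theorem minResidual_zero : minResidual A b 0 = ‖b‖ := by
  obtain ⟨p, hp, h⟩ := (isLeast_minResidual A b 0).1
  have hp0 : p = 0 := by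
    by_contra h0
    rw [degree_eq_natDegree h0] at hp
    exact absurd hp (by simp)
  rw [h, hp0]
  simp

theorem IsMinresPoly.norm_eq {n : ℕ} {p : ℝ[X]} (h : IsMinresPoly A b n p) :
    ‖krylovMap A b (1 - X * p)‖ = minResidual A b n := by
  refine le_antisymm ?_ (minResidual_le h.degree_lt)
  obtain ⟨q, hq, hqr⟩ := (isLeast_minResidual A b n).1
  rw [hqr, ← krylovMap_one_sub_X_mul]
  have horth := h.orthogonal (p - q) (degree_sub_lt_of_lt h.degree_lt hq)
  have hsplit : krylovMap A b (1 - X * q) =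
      krylovMap A b (X * (p - q)) + krylovMap A b (1 - X * p) := by
    rw [← map_add]
    congr 1
    ring
  have hsq := norm_add_sq_eq_norm_sq_add_norm_sq_of_inner_eq_zero _ _ horth
  rw [← hsplit] at hsq
  nlinarith [norm_nonneg (krylovMap A b (1 - X * q)), norm_nonneg (krylovMap A b (1 - X * p)),
    mul_self_nonneg ‖krylovMap A b (X * (p - q))‖]

variable (A b) in
theorem exists_isMinresPoly (n : ℕ) : ∃ p : ℝ[X], IsMinresPoly A b n p := by
  let L : ℝ[X] →ₗ[ℝ] EuclideanSpace ℝ (Fin d) := krylovMap A b ∘ₗ LinearMap.mulLeft ℝ X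
  let W := (degreeLT ℝ n).map L
  obtain ⟨p, hp, hpv⟩ := Submodule.mem_map.1 (W.starProjection_apply_mem b)
  refine ⟨p, mem_degreeLT.1 hp, fun q hq => ?_⟩
  have hr : krylovMap A b (1 - X * p) = b - W.starProjection b := by
    rw [map_sub, krylovMap_one, ← hpv]
    rfl
  rw [hr, real_inner_comm]
  exact W.starProjection_inner_eq_zero b _ (Submodule.mem_map_of_mem (f := L) (mem_degreeLT.2 hq))

/-- If the minimal residual strictly decreases, the Krylov vectors are linearly independent. -/
theorem eq_zero_of_krylovMap_eq_zero {n : ℕ} (hlt : minResidual A b (n + 1) < minResidual A b n)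
    {q : ℝ[X]} (hq : q.degree < (n + 1 : ℕ)) (h : krylovMap A b q = 0) : q = 0 := by
  by_contra h0
  obtain ⟨p, -, hpr⟩ := (isLeast_minResidual A b (n + 1)).1
  rw [← krylovMap_one_sub_X_mul] at hpr
  refine hlt.not_ge ?_
  have hdeg : (p % q).degree < n := by
    refine (EuclideanDomain.mod_lt p h0).trans_le ?_
    rw [degree_eq_natDegree h0] at hq ⊢
    norm_cast at hq ⊢
    omega
  calc minResidual A b n ≤ ‖krylovMap A b (1 - X * (p % q))‖ := minResidual_le hdeg
    _ = minResidual A b (n + 1) := by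
      rw [hpr, map_sub, map_sub, krylovMap_X_mul, krylovMap_X_mul, krylovMap_mod A b h]

/-- If the minimal residual strictly decreases, `A` compressed to the Krylov subspace is
nonsingular. -/
theorem eq_zero_of_galerkin {n : ℕ} (hlt : minResidual A b (n + 1) < minResidual A b n)
    {p : ℝ[X]} (hp : p.degree < (n + 1 : ℕ))
    (h : ∀ q : ℝ[X], q.degree < (n + 1 : ℕ) → ⟪krylovMap A b (X * p), krylovMap A b q⟫ = 0) :
    p = 0 := by
  by_cases hpn : p.degree < n
  · have hX := eq_zero_of_krylovMap_eq_zero hlt (degree_X_mul_lt hpn)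
      (inner_self_eq_zero.1 (h _ (degree_X_mul_lt hpn)))
    simpa using hX
  · exfalso
    obtain ⟨r, hr⟩ := exists_isMinresPoly A b n
    -- The residual polynomial 1 - X * r is an admissible test, so the new direction X * p is
    -- orthogonal to it: r stays optimal at order n + 1, and there is no drop.
    have hr' : IsMinresPoly A b (n + 1) r := by
      refine ⟨degree_lt_succ_of_lt hr.degree_lt, fun q hq => ?_⟩
      obtain ⟨c, hc⟩ := exists_degree_sub_C_mul_lt hp hpn hq
      have hsplit : X * q = X * (q - C c * p) + c • (X * p) := by
        rw [smul_eq_C_mul]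
        ring
      rw [hsplit, map_add, map_smul, inner_add_left, real_inner_smul_left, hr.orthogonal _ hc,
        h _ (degree_one_sub_X_mul_lt hr.degree_lt)]
      simp
    exact hlt.ne (hr'.norm_eq.symm.trans hr.norm_eq)

/-- The relation between the residual norms of the Galerkin and the minimal residual iterates. -/
theorem norm_galerkin_residual {n : ℕ} (hlt : minResidual A b (n + 1) < minResidual A b n)
    {p : ℝ[X]} (hp : p.degree < (n + 1 : ℕ))
    (h : ∀ q : ℝ[X], q.degree < (n + 1 : ℕ) →
      ⟪krylovMap A b (1 - X * p), krylovMap A b q⟫ = 0) :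
    ‖krylovMap A b (1 - X * p)‖ ^ 2 * (minResidual A b n ^ 2 - minResidual A b (n + 1) ^ 2) =
      minResidual A b (n + 1) ^ 2 * minResidual A b n ^ 2 := by
  obtain ⟨r, hr⟩ := exists_isMinresPoly A b n
  obtain ⟨s, hs⟩ := exists_isMinresPoly A b (n + 1)
  have hρ := hr.norm_eq
  have hσ := hs.norm_eq
  set φ := krylovMap A b
  have hw := degree_sub_lt_of_lt hs.degree_lt (degree_lt_succ_of_lt hr.degree_lt)
  have hu := degree_sub_lt_of_lt hs.degree_lt hp
  have hrs : φ (1 - X * r) = φ (X * (s - r)) + φ (1 - X * s) := by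
    rw [← map_add]; congr 1; ring
  have hps : φ (1 - X * p) = φ (X * (s - p)) + φ (1 - X * s) := by
    rw [← map_add]; congr 1; ring
  -- Both X * (s - r) and X * (s - p) map into A K_{n+1}, orthogonally to A K_n. That complement is
  -- at most a line, so the second image is c times the first.
  have hwo : ∀ q : ℝ[X], q.degree < n → ⟪φ (X * q), φ (X * (s - r))⟫ = 0 := fun q hq => by
    have h1 := hr.orthogonal q hq
    rwa [hrs, inner_add_right, hs.orthogonal q (degree_lt_succ_of_lt hq), add_zero] at h1
  have huo : ∀ q : ℝ[X], q.degree < n → ⟪φ (X * q), φ (X * (s - p))⟫ = 0 := fun q hq => by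
    have h1 := h (X * q) (degree_X_mul_lt hq)
    rwa [real_inner_comm, hps, inner_add_right, hs.orthogonal q (degree_lt_succ_of_lt hq),
      add_zero] at h1
  have hsw : ⟪φ (X * (s - r)), φ (1 - X * s)⟫ = 0 := hs.orthogonal _ hw
  have hsu : ⟪φ (X * (s - p)), φ (1 - X * s)⟫ = 0 := hs.orthogonal _ hu
  have hρσ := norm_add_sq_eq_norm_sq_add_norm_sq_of_inner_eq_zero _ _ hsw
  rw [← hrs, hρ, hσ] at hρσ
  have hτσ := norm_add_sq_eq_norm_sq_add_norm_sq_of_inner_eq_zero _ _ hsu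
  rw [← hps, hσ] at hτσ
  have hnot : ¬ (s - r).degree < n := fun hdeg => by
    have h0 : φ (X * (s - r)) = 0 := inner_self_eq_zero.1 (hwo _ hdeg)
    rw [h0] at hρσ
    simp only [norm_zero, mul_zero, zero_add] at hρσ
    exact hlt.ne ((mul_self_inj (minResidual_nonneg _) (minResidual_nonneg _)).1 hρσ).symm
  obtain ⟨c, hc⟩ := exists_degree_sub_C_mul_lt hw hnot hu
  have hsplit : φ (X * (s - p)) = φ (X * (s - p - C c * (s - r))) + c • φ (X * (s - r)) := by
    rw [← map_smul, ← map_add, smul_eq_C_mul]; congr 1; ring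
  have hz : φ (X * (s - p - C c * (s - r))) = 0 := by
    have h1 := huo _ hc
    rwa [hsplit, inner_add_right, real_inner_smul_right, hwo _ hc, mul_zero, add_zero,
      inner_self_eq_zero] at h1
  rw [hz, zero_add] at hsplit
  -- Testing the Galerkin condition against the residual of order n yields c ω² + σ² = 0, which
  -- determines c.
  have hort := h _ (degree_one_sub_X_mul_lt hr.degree_lt)
  rw [hps, hrs, hsplit, inner_add_left, inner_add_right, inner_add_right, real_inner_smul_left,
    real_inner_smul_left, hsw, real_inner_comm (φ (X * (s - r))) (φ (1 - X * s)), hsw,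
    real_inner_self_eq_norm_sq, real_inner_self_eq_norm_sq, hσ] at hort
  rw [hsplit, norm_smul, Real.norm_eq_abs] at hτσ
  set ω := ‖φ (X * (s - r))‖
  set σ := minResidual A b (n + 1)
  set ρ := minResidual A b n
  set τ := ‖φ (1 - X * p)‖
  have hτ : τ ^ 2 = c ^ 2 * ω ^ 2 + σ ^ 2 := by
    rw [← sq_abs c]; linarith
  have hωρ : ρ ^ 2 = ω ^ 2 + σ ^ 2 := by linarith
  have hcσ : σ ^ 2 = -(c * ω ^ 2) := by linarith
  rw [hτ, hωρ, hcσ]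
  ring

end KrylovMap

/-! ### Lanczos bases and the Lanczos iterate -/

theorem isUnit_of_toEuclideanLin_eq_zero {n : ℕ} {M : Matrix (Fin n) (Fin n) ℝ}
    (h : ∀ v, Matrix.toEuclideanLin M v = 0 → v = 0) : IsUnit M := by
  rw [← Matrix.mulVec_injective_iff_isUnit, ← Matrix.coe_mulVecLin, injective_iff_map_eq_zero]
  intro v hv
  have h1 := h (WithLp.toLp 2 v) (by
    rw [Matrix.toLpLin_toLp]
    simpa using hv)
  simpa using h1

namespace IsLanczosBasis

variable {d k : ℕ} {A : Matrix (Fin d) (Fin d) ℝ} {b : EuclideanSpace ℝ (Fin d)}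
  {Q : Matrix (Fin d) (Fin k) ℝ}

theorem transpose_mul_self (hQ : IsLanczosBasis A b Q) : Qᵀ * Q = 1 := by
  ext i j
  have h := orthonormal_iff_ite.1 hQ.orthonormal i j
  rw [Matrix.one_apply, ← h]
  simp [Matrix.mul_apply, PiLp.inner_apply, mul_comm]

theorem range_eq (hQ : IsLanczosBasis A b Q) :
    LinearMap.range (Matrix.toEuclideanLin Q) = krylov A b k := by
  have h : {i : Fin k | (i : ℕ) < k} = Set.univ := by
    ext i
    simp
  rw [← hQ.span_eq k le_rfl, h, Set.image_univ]
  apply le_antisymm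
  · rintro _ ⟨v, rfl⟩
    have hv : Matrix.toEuclideanLin Q v = ∑ i, v i • WithLp.toLp 2 (Q.col i) := by
      ext j
      simp [Matrix.toLpLin_apply, Matrix.mulVec, dotProduct, mul_comm]
    rw [hv]
    exact Submodule.sum_mem _ fun i _ =>
      Submodule.smul_mem _ _ (Submodule.subset_span (Set.mem_range_self i))
  · rw [Submodule.span_le]
    rintro _ ⟨i, rfl⟩
    refine ⟨EuclideanSpace.single i 1, ?_⟩
    ext j
    simp [Matrix.toLpLin_apply]

theorem inner_eq_zero (hQ : IsLanczosBasis A b Q) {v : EuclideanSpace ℝ (Fin d)}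
    (hv : Matrix.toEuclideanLin Qᵀ v = 0) {q : ℝ[X]} (hq : q.degree < k) :
    ⟪v, krylovMap A b q⟫ = 0 := by
  have hmem := (mem_krylov A b).2 ⟨q, hq, rfl⟩
  rw [← hQ.range_eq] at hmem
  obtain ⟨w, hw⟩ := hmem
  rw [← hw, real_inner_comm, inner_toEuclideanLin_left, hv, inner_zero_right]

theorem exists_krylovMap_eq (hQ : IsLanczosBasis A b Q) (v : EuclideanSpace ℝ (Fin k)) :
    ∃ p : ℝ[X], p.degree < k ∧ krylovMap A b p = Matrix.toEuclideanLin Q v := by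
  rw [← mem_krylov, ← hQ.range_eq]
  exact ⟨v, rfl⟩

theorem toEuclideanLin_transpose_self (hQ : IsLanczosBasis A b Q)
    (v : EuclideanSpace ℝ (Fin k)) :
    Matrix.toEuclideanLin Qᵀ (Matrix.toEuclideanLin Q v) = v := by
  rw [← toEuclideanLin_mul_apply, hQ.transpose_mul_self, toEuclideanLin_one_apply]

end IsLanczosBasis

section Lanczos

variable {d : ℕ} {A : Matrix (Fin d) (Fin d) ℝ} {b : EuclideanSpace ℝ (Fin d)}

theorem isUnit_projected {n : ℕ} (hlt : minResidual A b (n + 1) < minResidual A b n)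
    {Q : Matrix (Fin d) (Fin (n + 1)) ℝ} (hQ : IsLanczosBasis A b Q) :
    IsUnit (projected A Q) := by
  refine isUnit_of_toEuclideanLin_eq_zero fun v hv => ?_
  obtain ⟨p, hp, hpv⟩ := hQ.exists_krylovMap_eq v
  rw [projected, Matrix.mul_assoc, toEuclideanLin_mul_apply, toEuclideanLin_mul_apply, ← hpv,
    ← krylovMap_X_mul] at hv
  have hp0 := eq_zero_of_galerkin hlt hp fun q hq => hQ.inner_eq_zero hv hq
  rw [← hQ.toEuclideanLin_transpose_self v, ← hpv, hp0]
  simp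

theorem projected_mul_cfc {k : ℕ} (hA : A.IsSymm) {Q : Matrix (Fin d) (Fin k) ℝ}
    (hT : IsUnit (projected A Q)) :
    projected A Q * cfc (fun x : ℝ => 1 / x) (projected A Q) = 1 := by
  have hsa : IsSelfAdjoint (projected A Q) := by
    rw [IsSelfAdjoint, Matrix.star_eq_conjTranspose, Matrix.conjTranspose_eq_transpose_of_trivial,
      projected, Matrix.transpose_mul, Matrix.transpose_mul, Matrix.transpose_transpose, hA.eq,
      Matrix.mul_assoc]
  simp only [one_div]
  rw [cfc_ringInverse_id _ hT hsa, Ring.mul_inverse_cancel _ hT]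

theorem norm_lan_residual (hA : A.IsSymm) {n : ℕ}
    (hlt : minResidual A b (n + 1) < minResidual A b n)
    {Q : Matrix (Fin d) (Fin (n + 1)) ℝ} (hQ : IsLanczosBasis A b Q) :
    ‖b - Matrix.toEuclideanLin A (lan A b Q fun x => 1 / x)‖ ^ 2 *
        (minResidual A b n ^ 2 - minResidual A b (n + 1) ^ 2) =
      minResidual A b (n + 1) ^ 2 * minResidual A b n ^ 2 := by
  set S := cfc (fun x : ℝ => 1 / x) (projected A Q)
  obtain ⟨p, hp, hpv⟩ :=
    hQ.exists_krylovMap_eq (Matrix.toEuclideanLin S (Matrix.toEuclideanLin Qᵀ b))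
  have hlan : lan A b Q (fun x => 1 / x) = krylovMap A b p := by
    rw [hpv, lan, Matrix.mul_assoc, toEuclideanLin_mul_apply, toEuclideanLin_mul_apply]
  have hres : b - Matrix.toEuclideanLin A (lan A b Q fun x => 1 / x) =
      krylovMap A b (1 - X * p) := by
    rw [hlan, map_sub, krylovMap_one, krylovMap_X_mul]
  rw [hres]
  -- Since T f(T) = 1, the residual is annihilated by Qᵀ: this is the Galerkin condition.
  refine norm_galerkin_residual hlt hp fun q hq => hQ.inner_eq_zero ?_ hq
  rw [← hres, hlan, hpv, map_sub, ← toEuclideanLin_mul_apply, ← toEuclideanLin_mul_apply,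
    ← toEuclideanLin_mul_apply, ← projected,
    projected_mul_cfc hA (isUnit_projected hlt hQ), toEuclideanLin_one_apply, sub_self]

theorem exists_isLanczosBasis {n : ℕ} (hli : ∀ q : ℝ[X], q.degree < n → krylovMap A b q = 0 → q = 0) :
    ∃ Q : Matrix (Fin d) (Fin n) ℝ, IsLanczosBasis A b Q := by
  let f : Fin n → EuclideanSpace ℝ (Fin d) := fun i => Matrix.toEuclideanLin (A ^ (i : ℕ)) b
  have hf : LinearIndependent ℝ f := by
    rw [Fintype.linearIndependent_iff]
    intro g hg i
    have hdeg : (∑ j : Fin n, C (g j) * X ^ (j : ℕ) : ℝ[X]).degree < n :=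
      degree_sum_fin_lt g
    have h0 := hli _ hdeg (by
      rw [← hg, map_sum]
      refine Finset.sum_congr rfl fun j _ => ?_
      rw [← smul_eq_C_mul, map_smul, krylovMap_apply, map_pow, aeval_X])
    have hc := congrArg (fun p : ℝ[X] => p.coeff i) h0
    simpa [finsetSum_coeff, coeff_X_pow, Fin.val_inj] using hc
  refine ⟨Matrix.of fun i j => InnerProductSpace.gramSchmidtNormed ℝ f j i, ?_, fun j hj => ?_⟩
  · exact InnerProductSpace.gramSchmidtNormed_orthonormal hf
  · change Submodule.span ℝ (InnerProductSpace.gramSchmidtNormed ℝ f '' _) = _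
    rw [InnerProductSpace.span_gramSchmidtNormed]
    have hspan : Submodule.span ℝ (InnerProductSpace.gramSchmidt ℝ f '' {i : Fin n | (i : ℕ) < j}) =
        Submodule.span ℝ (f '' {i : Fin n | (i : ℕ) < j}) := by
      -- For j = n there is no element j of `Fin n` to bound an initial segment.
      rcases hj.eq_or_lt with rfl | hj
      · have h : {i : Fin j | (i : ℕ) < j} = Set.univ := by
          ext i
          simp
        rw [h, Set.image_univ, Set.image_univ, InnerProductSpace.span_gramSchmidt]
      · exact InnerProductSpace.span_gramSchmidt_Iio ℝ f ⟨j, hj⟩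
    rw [hspan, krylov]
    congr 1
    ext v
    constructor
    · rintro ⟨i, hi, rfl⟩
      exact ⟨⟨i, hi⟩, rfl⟩
    · rintro ⟨i, rfl⟩
      exact ⟨⟨i, i.2.trans_le hj⟩, i.2, rfl⟩

/-- A nonincreasing sequence `ρ` has an index where it drops by at least the average amount,
measured by the increments of `1 / ρ ^ 2`. -/
theorem exists_large_drop {ρ : ℕ → ℝ} (h0 : ∀ n, 0 ≤ ρ n) (hanti : ∀ n, ρ (n + 1) ≤ ρ n) (k : ℕ) :
    ρ 0 ^ 2 ≤ (k + 1) * ρ k ^ 2 ∨ ∃ n < k, ρ (n + 1) < ρ n ∧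
      ρ (n + 1) ^ 2 * ρ n ^ 2 ≤ (k + 1) * ρ k ^ 2 * (ρ n ^ 2 - ρ (n + 1) ^ 2) := by
  induction k with
  | zero => simp
  | succ k ih =>
    -- For positive ρ, the second inequality says that the last increment of 1/ρ² is at least 1/((k
    -- + 2)ρ_{k+1}²). If it fails, (k + 1)ρ_k² ≤ (k + 2)ρ_{k+1}², so the earlier choice still works.
    by_cases hlarge : ρ (k + 1) < ρ k ∧ (k + 2) * ρ (k + 1) ^ 2 ≤ (k + 1) * ρ k ^ 2
    · refine Or.inr ⟨k, k.lt_succ_self, hlarge.1, ?_⟩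
      push_cast
      nlinarith [mul_le_mul_of_nonneg_left hlarge.2 (sq_nonneg (ρ (k + 1)))]
    have hle : (k + 1) * ρ k ^ 2 ≤ (k + 2) * ρ (k + 1) ^ 2 := by
      rcases (hanti k).eq_or_lt with h | h
      · rw [h]
        nlinarith [sq_nonneg (ρ k)]
      · exact (not_le.1 fun h' => hlarge ⟨h, h'⟩).le
    have hcast : ((k + 1 : ℕ) : ℝ) + 1 = k + 2 := by
      push_cast
      ring
    rw [hcast]
    rcases ih with h | ⟨n, hn, hlt, h⟩
    · exact Or.inl (h.trans hle)
    · refine Or.inr ⟨n, hn.trans k.lt_succ_self, hlt, h.trans ?_⟩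
      refine mul_le_mul_of_nonneg_right hle (sub_nonneg.2 ?_)
      exact pow_le_pow_left₀ (h0 _) (hanti n) 2

theorem exists_lan_residual_le (hA : A.IsSymm) (k : ℕ) :
    ∃ j ≤ k, (∃ Q : Matrix (Fin d) (Fin j) ℝ, IsLanczosBasis A b Q) ∧
      ∀ Q : Matrix (Fin d) (Fin j) ℝ, IsLanczosBasis A b Q → IsUnit (projected A Q) ∧
        ‖b - Matrix.toEuclideanLin A (lan A b Q fun x => 1 / x)‖ ≤
          √(k + 1) * minResidual A b k := by
  have hsqrt : ∀ x : ℝ, x ^ 2 ≤ (k + 1) * minResidual A b k ^ 2 →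
      x ≤ √(k + 1) * minResidual A b k := fun x hx => by
    refine le_of_sq_le_sq ?_ (mul_nonneg (Real.sqrt_nonneg _) (minResidual_nonneg k))
    rw [mul_pow, Real.sq_sqrt (by positivity)]
    exact hx
  rcases exists_large_drop (minResidual_nonneg (A := A) (b := b)) minResidual_succ_le k with
    h | ⟨n, hn, hlt, h⟩
  · refine ⟨0, k.zero_le, exists_isLanczosBasis fun q hq _ => ?_, fun Q hQ => ⟨?_, hsqrt _ ?_⟩⟩
    · by_contra h0
      rw [degree_eq_natDegree h0] at hq
      exact absurd hq (by simp)
    · exact isUnit_of_subsingleton _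
    · have hlan : lan A b Q (fun x => 1 / x) = 0 := by
        ext i
        simp [lan]
      rwa [hlan, map_zero, sub_zero, ← minResidual_zero (A := A)]
  · refine ⟨n + 1, hn, exists_isLanczosBasis fun q hq => eq_zero_of_krylovMap_eq_zero hlt hq,
      fun Q hQ => ⟨isUnit_projected hlt hQ, hsqrt _ ?_⟩⟩
    rw [← norm_lan_residual hA hlt hQ] at h
    refine le_of_mul_le_mul_right h (sub_pos.2 ?_)
    exact pow_lt_pow_left₀ hlt (minResidual_nonneg _) two_ne_zero

end Lanczos

/-! ### From residuals to errors -/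

section Condition

variable {d : ℕ} {A : Matrix (Fin d) (Fin d) ℝ}

theorem norm_sq_toEuclideanLin_eq_sum (hA : A.IsHermitian) (v : EuclideanSpace ℝ (Fin d)) :
    ‖Matrix.toEuclideanLin A v‖ ^ 2 =
      ∑ i, hA.eigenvalues i ^ 2 * ⟪hA.eigenvectorBasis i, v⟫ ^ 2 := by
  rw [← hA.eigenvectorBasis.sum_sq_norm_inner_right]
  refine Finset.sum_congr rfl fun i _ => ?_
  have hev : Matrix.toEuclideanLin A (hA.eigenvectorBasis i) =
      hA.eigenvalues i • hA.eigenvectorBasis i := by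
    ext j
    simpa using congrFun (hA.mulVec_eigenvectorBasis i) j
  have hT : Aᵀ = A := by
    rw [← Matrix.conjTranspose_eq_transpose_of_trivial]
    exact hA.eq
  rw [real_inner_comm, inner_toEuclideanLin_left, hT, hev, real_inner_smul_right, Real.norm_eq_abs,
    sq_abs, mul_pow, real_inner_comm]

theorem finite_abs_spectrum (A : Matrix (Fin d) (Fin d) ℝ) :
    ((fun x : ℝ => |x|) '' spectrum ℝ A).Finite :=
  (Matrix.finite_real_spectrum (A := A)).image _

theorem norm_toEuclideanLin_le (hA : A.IsHermitian) (v : EuclideanSpace ℝ (Fin d)) :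
    ‖Matrix.toEuclideanLin A v‖ ≤ sSup ((fun x : ℝ => |x|) '' spectrum ℝ A) * ‖v‖ := by
  have hM : 0 ≤ sSup ((fun x : ℝ => |x|) '' spectrum ℝ A) :=
    Real.sSup_nonneg (by rintro _ ⟨x, -, rfl⟩; exact abs_nonneg x)
  refine le_of_sq_le_sq ?_ (mul_nonneg hM (norm_nonneg v))
  rw [norm_sq_toEuclideanLin_eq_sum hA, mul_pow, ← hA.eigenvectorBasis.sum_sq_norm_inner_right,
    Finset.mul_sum]
  refine Finset.sum_le_sum fun i _ => ?_
  rw [Real.norm_eq_abs, sq_abs, ← sq_abs (hA.eigenvalues i)]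
  gcongr
  exact le_csSup (finite_abs_spectrum A).bddAbove ⟨_, hA.eigenvalues_mem_spectrum_real i, rfl⟩

theorem mul_norm_le_norm_toEuclideanLin (hA : A.IsHermitian) (v : EuclideanSpace ℝ (Fin d)) :
    sInf ((fun x : ℝ => |x|) '' spectrum ℝ A) * ‖v‖ ≤ ‖Matrix.toEuclideanLin A v‖ := by
  have hm : 0 ≤ sInf ((fun x : ℝ => |x|) '' spectrum ℝ A) :=
    Real.sInf_nonneg (by rintro _ ⟨x, -, rfl⟩; exact abs_nonneg x)
  refine le_of_sq_le_sq ?_ (norm_nonneg _)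
  rw [norm_sq_toEuclideanLin_eq_sum hA, mul_pow, ← hA.eigenvectorBasis.sum_sq_norm_inner_right,
    Finset.mul_sum]
  refine Finset.sum_le_sum fun i _ => ?_
  rw [Real.norm_eq_abs, sq_abs, ← sq_abs (hA.eigenvalues i)]
  gcongr
  exact csInf_le (finite_abs_spectrum A).bddBelow ⟨_, hA.eigenvalues_mem_spectrum_real i, rfl⟩

theorem norm_le_cond_mul (hA : A.IsHermitian) (hU : IsUnit A) {v w : EuclideanSpace ℝ (Fin d)}
    {c : ℝ} (hc : 0 ≤ c)
    (h : ‖Matrix.toEuclideanLin A v‖ ≤ c * ‖Matrix.toEuclideanLin A w‖) :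
    ‖v‖ ≤ cond A * c * ‖w‖ := by
  -- For d = 0 the spectrum is empty, and the infimum takes the default value 0.
  rcases d.eq_zero_or_pos with rfl | hd
  · simp [Subsingleton.elim v 0, Subsingleton.elim w 0]
  have hpos : 0 < sInf ((fun x : ℝ => |x|) '' spectrum ℝ A) := by
    have hne : ((fun x : ℝ => |x|) '' spectrum ℝ A).Nonempty :=
      ⟨_, _, hA.eigenvalues_mem_spectrum_real ⟨0, hd⟩, rfl⟩
    obtain ⟨x, hx, hxe⟩ := hne.csInf_mem (finite_abs_spectrum A)
    rw [← hxe]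
    refine abs_pos.2 ?_
    rintro rfl
    exact spectrum.zero_notMem ℝ hU hx
  rw [cond, div_mul_eq_mul_div, div_mul_eq_mul_div, le_div_iff₀ hpos]
  calc ‖v‖ * sInf ((fun x : ℝ => |x|) '' spectrum ℝ A) ≤ ‖Matrix.toEuclideanLin A v‖ := by
        rw [mul_comm]
        exact mul_norm_le_norm_toEuclideanLin hA v
    _ ≤ c * ‖Matrix.toEuclideanLin A w‖ := h
    _ ≤ c * (sSup ((fun x : ℝ => |x|) '' spectrum ℝ A) * ‖w‖) := by
        gcongr
        exact norm_toEuclideanLin_le hA w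
    _ = _ := by ring

end Condition

theorem sqrt_add_one_le {k : ℕ} (hk : 1 ≤ k) :
    √((k : ℝ) + 1) ≤ Real.exp 1 * √(k : ℝ) + 1 / √(k : ℝ) := by
  have hk' : (1 : ℝ) ≤ k := by exact_mod_cast hk
  have h2 : (2 : ℝ) ≤ Real.exp 1 := by linarith [Real.add_one_le_exp (1 : ℝ)]
  calc √((k : ℝ) + 1) ≤ 2 * √(k : ℝ) := by
        rw [Real.sqrt_le_left (by positivity), mul_pow, Real.sq_sqrt (by positivity)]
        linarith
    _ ≤ Real.exp 1 * √(k : ℝ) := by gcongr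
    _ ≤ _ := le_add_of_nonneg_right (by positivity)

end LanczosFA

end

theorem mainTheorem3 {d : ℕ} (A : Matrix (Fin d) (Fin d) ℝ) (hA : A.IsSymm)
    (b : EuclideanSpace ℝ (Fin d)) (k : ℕ) (hk : 1 ≤ k) :
    ∃ kstar : ℕ, kstar ≤ k ∧
      (∃ Q : Matrix (Fin d) (Fin kstar) ℝ, LanczosFA.IsLanczosBasis A b Q) ∧
      ∀ Q : Matrix (Fin d) (Fin kstar) ℝ, LanczosFA.IsLanczosBasis A b Q →
        IsUnit (LanczosFA.projected A Q) ∧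
        ‖b - Matrix.toEuclideanLin A (LanczosFA.lan A b Q fun x => 1 / x)‖ ≤
          (Real.exp 1 * √(k : ℝ) + 1 / √(k : ℝ)) * LanczosFA.minResidual A b k ∧
        (IsUnit A →
          ‖Matrix.toEuclideanLin A⁻¹ b - LanczosFA.lan A b Q fun x => 1 / x‖ ≤
            LanczosFA.cond A * (Real.exp 1 * √(k : ℝ) + 1 / √(k : ℝ)) *
              LanczosFA.minError A b k) := by
  obtain ⟨j, hj, hex, h⟩ := LanczosFA.exists_lan_residual_le (b := b) hA k
  refine ⟨j, hj, hex, fun Q hQ => ?_⟩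
  obtain ⟨hT, hres⟩ := h Q hQ
  have hres' := hres.trans (mul_le_mul_of_nonneg_right (LanczosFA.sqrt_add_one_le hk)
    (LanczosFA.minResidual_nonneg k))
  refine ⟨hT, hres', fun hU => ?_⟩
  obtain ⟨p, hp, hpr⟩ := (LanczosFA.isLeast_minError A b k).1
  rw [hpr]
  -- A maps the error of any approximation v to its residual b - A v.
  have hAinv : ∀ v, Matrix.toEuclideanLin A (Matrix.toEuclideanLin A⁻¹ b - v) =
      b - Matrix.toEuclideanLin A v := fun v => by
    rw [map_sub, ← LanczosFA.toEuclideanLin_mul_apply,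
      Matrix.mul_nonsing_inv _ ((Matrix.isUnit_iff_isUnit_det A).1 hU),
      LanczosFA.toEuclideanLin_one_apply]
  have hherm : A.IsHermitian := by
    rw [Matrix.IsHermitian, Matrix.conjTranspose_eq_transpose_of_trivial]
    exact hA
  refine LanczosFA.norm_le_cond_mul hherm hU (by positivity) ?_
  rw [hAinv, hAinv, ← LanczosFA.toEuclideanLin_mul_apply]
  refine hres'.trans (mul_le_mul_of_nonneg_left ?_ (by positivity))
  exact (LanczosFA.isLeast_minResidual A b k).2 ⟨p, hp, rfl⟩
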